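/- **Theorem.** Let $\mathcal G$ be a compact, second countable, Hausdorff topological group with normalised Haar measure $\lambda$ on its Borel sets. Let $\mathcal X$ be a non-empty Polish space with its Borel $\sigma$-algebra, and let $\mathcal G$ act on $\mathcal X$ so that $(g,x)\mapsto gx$ is measurable. Let $\mu$ be a $\mathcal G$-invariant Borel probability measure on $\mathcal X$ with $\operatorname{supp}\mu=\mathcal X$. Let $\mathcal H$ be a reproducing kernel Hilbert space (RKHS) of functions $\mathcal X\to\mathbb R$ whose reproducing kernel $k:\mathcal X\times\mathcal X\to\mathbb R$ is measurable, satisfies $\sup_{x}k(x,x)<\infty$, and is such that $k(\cdot,x)$ is continuous for every $x\in\mathcal X$. Suppose that for all $x,x'\in\mathcal X$ $$\int_{\mathcal G}k(gx,x')\,d\lambda(g)=\int_{\mathcal G}k(x,gx')\,d\lambda(g).$$ Then for every $f\in\mathcal H$ and $x\in\mathcal X$ the function $g\mapsto f(gx)$ is $\lambda$-integrable, and, writing $$\mathcal Of(x)=\int_{\mathcal G}f(gx)\,d\lambda(g),\qquad \overline{\mathcal H}=\{f\in\mathcal H: f(gx)=f(x)\ \text{for all } g\in\mathcal G,\ x\in\mathcal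 X\},\qquad \mathcal H_\perp=\{f\in\mathcal H:\mathcal Of=0\},$$ the following hold. 1. $\mathcal Of\in\mathcal H$ for every $f\in\mathcal H$, and $\mathcal O:\mathcal H\to\mathcal H$ is a bounded, linear, self-adjoint, idempotent operator with range $\overline{\mathcal H}$; that is, $\mathcal O$ is the orthogonal projection of $\mathcal H$ onto $\overline{\mathcal H}$. 2. $\overline{\mathcal H}$ and $\mathcal H_\perp$ are linear subspaces of $\mathcal H$, and $\mathcal H=\overline{\mathcal H}\oplus\mathcal H_\perp$ is an orthogonal direct sum. 3. $\overline{\mathcal H}$, with the inner product of $\mathcal H$, is an RKHS with kernel $\overline k(x,y)=\int_{\mathcal G}k(x,gy)\,d\lambda(g)$. 4. $\mathcal H_\perp$, with the inner product of $\mathcal H$, is an RKHS with kernel $k^\perp(x,y)=k(x,y)-\overline k(x,y)$. -/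

import Mathlib

open MeasureTheory

/-- A linear subspace `W` of a real reproducing kernel Hilbert space `H` of functions on `X`, with
the inner product of `H`, is again an inner product space of functions on `X` on which point
evaluation is continuous: restrict the injection of `H` into the functions on `X`. -/
noncomputable instance Submodule.instRKHSOfReal {X H : Type*} [NormedAddCommGroup H]
    [InnerProductSpace ℝ H] [RKHS ℝ H X ℝ] (W : Submodule ℝ H) : RKHS ℝ W X ℝ where
  coeCLM := (RKHS.coeCLM ℝ : H →L[ℝ] X → ℝ).comp W.subtypeL
  coeCLM_injective := RKHS.coeCLM_injective.comp Subtype.val_injective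

/-- `H` is complete (hence a Hilbert space of real functions on `X` with continuous point
evaluations) and its reproducing kernel is `k`. Mathlib's kernel is operator valued, with values
`ℝ →L[ℝ] ℝ`; such an operator is identified with its value at `1`. -/
def IsRKHSWithKernel {X : Type*} (H : Type*) [NormedAddCommGroup H] [InnerProductSpace ℝ H]
    [RKHS ℝ H X ℝ] (k : X → X → ℝ) : Prop :=
  ∃ _ : CompleteSpace H, ∀ x y, RKHS.kernel H x y 1 = k x y

/-- The average `x ↦ ∫ f (g x) dλ(g)` of a function over the orbits of a group action. -/
noncomputable def orbitAverage {G X : Type*} [Group G] [MeasurableSpace G] [MulAction G X]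
    (lam : Measure G) (f : X → ℝ) (x : X) : ℝ :=
  ∫ g, f (g • x) ∂lam

/-- The kernel `k̄ (x, y) = ∫ k (x, g y) dλ(g)`, averaged over its second argument. -/
noncomputable def averagedKernel {G X : Type*} [Group G] [MeasurableSpace G] [MulAction G X]
    (lam : Measure G) (k : X → X → ℝ) (x y : X) : ℝ :=
  ∫ g, k x (g • y) ∂lam

open scoped InnerProductSpace

/-! The functional `f ↦ orbitAverage lam f x` is bounded, so it is `⟪·, φ x⟫` for some `φ x` in `H`.
The switch condition gives `φ x y = ∫ k x (g • y)`, which is invariant in `y` because Haar measure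
on a compact group is right invariant. Hence `⟪φ y, k(·, x) - φ x⟫ = 0`: `φ x` is the projection of
`k(·, x)` onto the closed span `W` of all `φ y`. Moving this self-adjoint projection across `⟪f,
k(·, x)⟫` shows that averaging is the projection onto `W`; kernels of subspaces are projected
kernels. -/

namespace MeasureTheory.Measure

/-- A Haar measure on a compact second countable group is right invariant. -/
theorem isMulRightInvariant_of_compactSpace {G : Type*} [Group G] [TopologicalSpace G]
    [IsTopologicalGroup G] [CompactSpace G] [MeasurableSpace G] [BorelSpace G]
    (lam : Measure G) [lam.IsHaarMeasure] [IsProbabilityMeasure lam] :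
    lam.IsMulRightInvariant where
  map_mul_right_eq_self h := by
    -- Left and right translations commute, so the translate is again Haar; Haar probability
    -- measures are unique.
    have : IsProbabilityMeasure (lam.map (· * h)) :=
      isProbabilityMeasure_map (measurable_mul_const h).aemeasurable
    exact isHaarMeasure_eq_of_isProbabilityMeasure _ _

end MeasureTheory.Measure

/-- Orbit averages are invariant under the action. -/
theorem orbitAverage_smul {G X : Type*} [Group G] [MeasurableSpace G] [MeasurableMul₂ G]
    [MulAction G X] (lam : Measure G) [lam.IsMulRightInvariant] (f : X → ℝ) (h : G) (x : X) :
    orbitAverage lam f (h • x) = orbitAverage lam f x := by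
  simp_rw [orbitAverage, smul_smul]
  exact integral_mul_right_eq_self (fun g ↦ f (g • x)) h

namespace RKHS

variable {X H : Type*} [NormedAddCommGroup H] [InnerProductSpace ℝ H] [RKHS ℝ H X ℝ]

theorem inner_kerFun_one [CompleteSpace H] (f : H) (x : X) : ⟪f, kerFun H x 1⟫_ℝ = f x := by
  simp

/-- The kernel function of a subspace is the projection of the kernel function of the space. -/
theorem coe_kerFun_submodule [CompleteSpace H] (W : Submodule ℝ H) [CompleteSpace W] (y : X) :
    (kerFun W y 1 : H) = W.starProjection (kerFun H y 1) := by
  have h : kerFun W y 1 = W.orthogonalProjectionOnto (kerFun H y 1) := by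
    refine ext_inner_left ℝ fun w ↦ ?_
    rw [inner_kerFun_one, Submodule.inner_orthogonalProjectionOnto_eq_of_mem_left,
      inner_kerFun_one]
    rfl
  rw [h, Submodule.starProjection_apply]

theorem kernel_submodule [CompleteSpace H] (W : Submodule ℝ H) [CompleteSpace W] (x y : X) :
    kernel W x y 1 = W.starProjection (kerFun H y 1) x := by
  rw [← kerFun_apply, ← coe_kerFun_submodule]
  rfl

/-- If all kernel functions are measurable, so are all elements of the space. -/
theorem measurable_coe [MeasurableSpace X] [CompleteSpace H]
    (h : ∀ x, Measurable (kerFun H x (1 : ℝ) : X → ℝ)) (f : H) : Measurable (f : X → ℝ) := by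
  have hf : f ∈ (Submodule.span ℝ {kerFun H x v | (x : X) (v : ℝ)}).topologicalClosure := by
    rw [kerFun_dense]; trivial
  -- Norm convergence implies pointwise convergence, which preserves measurability.
  obtain ⟨u, hu, hlim⟩ := mem_closure_iff_seq_limit.1 hf
  refine measurable_of_tendsto_metrizable (f := fun n ↦ (u n : X → ℝ)) (fun n ↦ ?_)
    (tendsto_pi_nhds.2 fun x ↦ ((continuous_eval x).tendsto f).comp hlim)
  refine Submodule.span_induction (p := fun (f : H) _ ↦ Measurable (f : X → ℝ)) ?_ ?_ ?_ ?_ (hu n)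
  · rintro _ ⟨x, v, rfl⟩
    have : kerFun H x v = v • kerFun H x (1 : ℝ) := by rw [← map_smul]; simp
    rw [this, coe_smul]
    exact (h x).const_smul v
  · simpa using measurable_zero
  · intro f g _ _ hf hg
    simpa using hf.add hg
  · intro c f _ hf
    simpa using hf.const_smul c

/-- Cauchy–Schwarz, since the kernel function at `x` has squared norm `k(x, x)`. -/
theorem abs_apply_le [CompleteSpace H] {C : ℝ} (hC : ∀ x, kernel H x x 1 ≤ C) (f : H) (x : X) :
    |f x| ≤ √C * ‖f‖ := by
  have h : ‖kerFun H x (1 : ℝ)‖ ≤ √C := by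
    refine Real.le_sqrt_of_sq_le ?_
    rw [← real_inner_self_eq_norm_sq, inner_kerFun_one, kerFun_apply]
    exact hC x
  rw [← inner_kerFun_one, mul_comm]
  exact (abs_real_inner_le_norm _ _).trans (by gcongr)

section Average

variable {G : Type*} [Group G] [MeasurableSpace G] [MulAction G X] [MeasurableSpace X]
  [MeasurableSMul₂ G X] [CompleteSpace H] (lam : Measure G) [IsProbabilityMeasure lam]

theorem integrable_orbit (h : ∀ x, Measurable (kerFun H x (1 : ℝ) : X → ℝ)) {C : ℝ}
    (hC : ∀ x, kernel H x x 1 ≤ C) (f : H) (x : X) : Integrable (fun g : G ↦ f (g • x)) lam :=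
  .of_bound ((measurable_coe h f).comp (measurable_id.smul_const x)).aestronglyMeasurable
    (√C * ‖f‖) (.of_forall fun _ ↦ abs_apply_le hC f _)

/-- The orbit average at a point is a bounded functional, so it is represented by a vector. -/
theorem exists_inner_eq_orbitAverage (h : ∀ x, Measurable (kerFun H x (1 : ℝ) : X → ℝ)) {C : ℝ}
    (hC : ∀ x, kernel H x x 1 ≤ C) (x : X) :
    ∃ φ : H, ∀ f : H, ⟪f, φ⟫_ℝ = orbitAverage lam f x := by
  let L : H →ₗ[ℝ] ℝ :=
    { toFun := fun f ↦ orbitAverage lam f x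
      map_add' := fun f g ↦ by
        simpa [orbitAverage] using
          integral_add (integrable_orbit lam h hC f x) (integrable_orbit lam h hC g x)
      map_smul' := fun c f ↦ by simp [orbitAverage, integral_const_mul] }
  let L' : H →L[ℝ] ℝ := L.mkContinuous (√C) fun f ↦ by
    simpa [L, orbitAverage] using norm_integral_le_of_norm_le_const (μ := lam)
      (f := fun g ↦ f (g • x)) (C := √C * ‖f‖)
      (.of_forall fun g : G ↦ abs_apply_le hC f (g • x))
  refine ⟨(InnerProductSpace.toDual ℝ H).symm L', fun f ↦ ?_⟩
  rw [real_inner_comm, InnerProductSpace.toDual_symm_apply]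
  rfl

/-- If averaging the kernel over its first or its second argument gives the same result, then
averaging over orbits is an orthogonal projection. -/
theorem exists_starProjection_eq_orbitAverage [MeasurableMul₂ G] [lam.IsMulRightInvariant]
    (h : ∀ x, Measurable (kerFun H x (1 : ℝ) : X → ℝ)) {C : ℝ} (hC : ∀ x, kernel H x x 1 ≤ C)
    (hswitch : ∀ x x', ∫ g : G, kernel H (g • x) x' 1 ∂lam = ∫ g : G, kernel H x (g • x') 1 ∂lam) :
    ∃ W : Submodule ℝ H, ∃ _ : CompleteSpace W,
      ∀ (f : H) (x : X), W.starProjection f x = orbitAverage lam f x := by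
  choose φ hφ using exists_inner_eq_orbitAverage (H := H) lam h hC
  have hφ_apply (x y : X) : φ x y = ∫ g : G, kernel H x (g • y) 1 ∂lam := by
    rw [← inner_kerFun_one, real_inner_comm, hφ, ← hswitch]
    simp [orbitAverage, kerFun_apply]
  have hφ_smul (g : G) (x y : X) : φ x (g • y) = φ x y := by
    rw [hφ_apply, hφ_apply]
    exact orbitAverage_smul lam (fun z ↦ kernel H x z 1) g y
  -- Pairing with `φ y` averages `φ x` over the orbit of `y`, where it is constant.
  have hφ_inner (x y : X) : ⟪φ x, φ y⟫_ℝ = φ x y := by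
    simp [hφ, orbitAverage, hφ_smul]
  let W := (Submodule.span ℝ (Set.range φ)).topologicalClosure
  have hW : CompleteSpace W := (Submodule.isClosed_topologicalClosure _).completeSpace_coe
  refine ⟨W, hW, fun f x ↦ ?_⟩
  have hproj : W.starProjection (kerFun H x 1) = φ x := by
    refine Submodule.eq_starProjection_of_mem_orthogonal
      (Submodule.le_topologicalClosure _ (Submodule.subset_span ⟨x, rfl⟩)) ?_
    rw [Submodule.orthogonal_closure, Submodule.mem_orthogonal]
    intro u hu
    induction hu using Submodule.span_induction with
    | mem u hu =>
      obtain ⟨y, rfl⟩ := hu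
      rw [inner_sub_right, inner_kerFun_one, hφ_inner, sub_self]
    | zero => simp
    | add u v _ _ hu hv => rw [inner_add_left, hu, hv, add_zero]
    | smul c u _ hu => rw [inner_smul_left, hu, mul_zero]
  rw [← inner_kerFun_one, Submodule.inner_starProjection_left_eq_right, hproj, hφ]

end Average

end RKHS

theorem mainTheorem6
    {G X H : Type*}
    [Group G] [TopologicalSpace G] [IsTopologicalGroup G] [CompactSpace G] [T2Space G]
    [SecondCountableTopology G] [MeasurableSpace G] [BorelSpace G]
    (lam : Measure G) [lam.IsHaarMeasure] [IsProbabilityMeasure lam]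
    [TopologicalSpace X] [PolishSpace X] [MeasurableSpace X] [BorelSpace X]
    [MulAction G X] [MeasurableSMul₂ G X]
    (μ : Measure X) [IsProbabilityMeasure μ] [SMulInvariantMeasure G X μ]
    (hμ : μ.support = Set.univ)
    [NormedAddCommGroup H] [InnerProductSpace ℝ H] [RKHS ℝ H X ℝ]
    (k : X → X → ℝ) (hH : IsRKHSWithKernel H k)
    (hk_meas : Measurable (fun p : X × X => k p.1 p.2))
    (hk_cont : ∀ x, Continuous (fun y => k y x))
    (hk_bdd : BddAbove (Set.range fun x => k x x))
    (hk_switch : ∀ x x', ∫ g : G, k (g • x) x' ∂lam = ∫ g : G, k x (g • x') ∂lam) :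
    (∀ (f : H) (x : X), Integrable (fun g : G => f (g • x)) lam) ∧
    ∃ (O : H →L[ℝ] H) (Hinv Hperp : Submodule ℝ H),
      (∀ (f : H) (x : X), (O f) x = orbitAverage lam f x) ∧
      (Hinv : Set H) = {f : H | ∀ (g : G) (x : X), f (g • x) = f x} ∧
      (Hperp : Set H) = {f : H | ∀ x : X, orbitAverage lam f x = 0} ∧
      (O : H →ₗ[ℝ] H).IsSymmetricProjection ∧
      O.range = Hinv ∧
      Hinv ⟂ Hperp ∧
      IsCompl Hinv Hperp ∧
      IsRKHSWithKernel Hinv (averagedKernel lam k) ∧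
      IsRKHSWithKernel Hperp (fun x y => k x y - averagedKernel lam k x y) := by
  obtain ⟨hcomplete, hkernel⟩ := hH
  obtain ⟨C, hC⟩ := hk_bdd
  have hC' (x : X) : RKHS.kernel H x x 1 ≤ C := hkernel x x ▸ hC ⟨x, rfl⟩
  have hmeas (x : X) : Measurable (RKHS.kerFun H x (1 : ℝ) : X → ℝ) := by
    have : (RKHS.kerFun H x (1 : ℝ) : X → ℝ) = fun y ↦ k y x :=
      funext fun y ↦ by rw [RKHS.kerFun_apply, hkernel]
    exact this ▸ (hk_cont x).measurable
  have := lam.isMulRightInvariant_of_compactSpace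
  obtain ⟨W, hW, hproj⟩ := RKHS.exists_starProjection_eq_orbitAverage lam hmeas hC'
    (by simpa only [hkernel] using hk_switch)
  -- The projection averages the first argument of `k`; the switch condition moves this to the
  -- second.
  have hkernelW (x y : X) : W.starProjection (RKHS.kerFun H y 1) x = averagedKernel lam k x y := by
    rw [hproj, averagedKernel, ← hk_switch]
    simp only [orbitAverage, RKHS.kerFun_apply, hkernel]
  refine ⟨RKHS.integrable_orbit lam hmeas hC', W.starProjection, W, Wᗮ, hproj, ?_, ?_,
    Submodule.isSymmetricProjection_starProjection W, Submodule.range_starProjection W,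
    Submodule.isOrtho_orthogonal_right W, Submodule.isCompl_orthogonal W,
    ⟨hW, fun x y ↦ by rw [RKHS.kernel_submodule, hkernelW]⟩, ⟨inferInstance, fun x y ↦ ?_⟩⟩
  -- Elements of `W` equal their own averages, hence are invariant; conversely, averaging fixes
  -- invariant functions as `lam` has mass one.
  · ext f
    rw [SetLike.mem_coe, ← Submodule.starProjection_eq_self_iff, Set.mem_ofPred_eq]
    constructor
    · intro hf g x
      rw [← hf, hproj, hproj, orbitAverage_smul]
    · intro hf
      ext x
      simp [hproj, orbitAverage, hf]
  · ext f
    rw [SetLike.mem_coe, ← Submodule.starProjection_apply_eq_zero_iff, Set.mem_ofPred_eq]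
    simp [DFunLike.ext_iff, hproj]
  · rw [RKHS.kernel_submodule, Submodule.starProjection_orthogonal_val, RKHS.coe_sub,
      Pi.sub_apply, hkernelW, RKHS.kerFun_apply, hkernel]
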